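/- **Setting.** Let $\mathcal V$ and $\mathcal W$ be symmetric monoidal model categories, i.e. closed symmetric monoidal categories with a model structure satisfying the pushout-product axiom and the unit axiom (for $x$ cofibrant and $q\colon Q\mathbb 1\to\mathbb 1$ a cofibrant replacement, $x\otimes Q\mathbb 1\to x\otimes \mathbb 1\cong x$ is a weak equivalence). Write $[v,v']$ for internal homs. A *weak monoidal Quillen adjunction* $F\colon\mathcal W\rightleftarrows\mathcal V\colon G$ is a Quillen adjunction with a lax monoidal structure on $G$ such that, for the corresponding oplax structure $\delta_{w,w'}\colon F(w\otimes w')\to Fw\otimes Fw'$, $\varepsilon\colon F(\mathbb 1_{\mathcal W})\to\mathbb 1_{\mathcal V}$ on $F$: (i) $\delta_{w,w'}$ is a weak equivalence for all cofibrant $w,w'$; (ii) for some cofibrant replacement $q\colon Q\mathbb 1_{\mathcal W}\to\mathbb 1_{\mathcal W}$ the composite $\varepsilon\circ F(q)$ is a weak equivalence. A *$\mathcal V$-enriched model category satisfying SM7* is a $\mathcal V$-category $\mathcal C$ with a model structure on its underlying category such that the initial object $\emptyset$ and the terminal object $*$ are so in the enriched sense (that is, $\underline{\mathcal C}(\emptyset,y)$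 and $\underline{\mathcal C}(x,*)$ are terminal in $\mathcal V$ for all $x,y$), and such that for every cofibration $a\to b$ and fibration $x\to y$ in $\mathcal C$ the map $\underline{\mathcal C}(b,x)\to\underline{\mathcal C}(a,x)\times_{\underline{\mathcal C}(a,y)}\underline{\mathcal C}(b,y)$ is a fibration in $\mathcal V$, acyclic if one of the two given maps is. A *weak tensoring* of such a $\mathcal C$ over $\mathcal V$ is a bifunctor $\otimes\colon\mathcal C\times\mathcal V\to\mathcal C$ (on underlying categories) such that $\emptyset\otimes v$ and $x\otimes\emptyset$ are initial for all $v$ and $x$, and which satisfies the external pushout-product axiom, with natural maps $\varphi_{v,x,y}\colon\underline{\mathcal C}(x\otimes v,y)\to[v,\underline{\mathcal C}(x,y)]$ that are weak equivalences for $v,x$ cofibrant and $y$ fibrant, and natural maps $\rho_x\colon x\otimes\mathbb 1\to x$, such that $\varphi_{\mathbb 1,x,y}\circ\rho_x^*$ is the canonical isomorphism $\underline{\mathcal C}(x,y)\cong[\mathbb 1,\underline{\mathcal C}(x,y)]$. It is *set-compatible* if every $\varphi_{v,x,y}$ induces a bijection $\mathcal V(\mathbb 1,\underline{\mathcal C}(x\otimes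 v,y))\to\mathcal V(\mathbb 1,[v,\underline{\mathcal C}(x,y)])$, and *unital* if every $\rho_x$ is an isomorphism. Dually, a *weak cotensoring* is a bifunctor $(y,v)\mapsto y^v$, $\mathcal C\times\mathcal V^{\mathrm{op}}\to\mathcal C$, such that $y^{\emptyset}$ and $*^v$ are terminal for all $y$ and $v$, and which satisfies the external pullback-power axiom, with natural maps $\psi_{v,x,y}\colon\underline{\mathcal C}(x,y^v)\to[v,\underline{\mathcal C}(x,y)]$ that are weak equivalences for $v,x$ cofibrant and $y$ fibrant, and natural maps $\eta_y\colon y\to y^{\mathbb 1}$, such that $\psi_{\mathbb 1,x,y}\circ(\eta_y)_*$ is the canonical isomorphism. It is *set-compatible* if every $\psi_{v,x,y}$ is bijective on underlying sets, and *unital* if every $\eta_y$ is an isomorphism. **Proposition.** Let $F\colon\mathcal W\rightleftarrows\mathcal V\colon G$ be a weak monoidal Quillen adjunction between symmetric monoidal model categories such that $\varepsilon\colon F(\mathbb 1_{\mathcal W})\to\mathbb 1_{\mathcal V}$ is an isomorphism, and let $\mathcal C$ be a $\mathcal V$-enriched model category satisfying SM7. Let $G_*\mathcal C$ be the $\mathcal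 W$-category with the same objects and hom-objects $G\underline{\mathcal C}(x,y)$; its underlying category is identified with that of $\mathcal C$ and is given the same model structure. Let $c_{w,v}\colon G[Fw,v]\to[w,Gv]$ be the map adjunct to the composite $F(w\otimes G[Fw,v])\xrightarrow{\delta}Fw\otimes FG[Fw,v]\to Fw\otimes[Fw,v]\xrightarrow{\mathrm{ev}}v$, whose middle arrow is given by the counit of $F\dashv G$. Then: 1. $G_*\mathcal C$ is a $\mathcal W$-enriched model category satisfying SM7. 2. If $(\otimes,\varphi,\rho)$ is a weak tensoring of $\mathcal C$ over $\mathcal V$, then $x\otimes w:=x\otimes Fw$, with the maps $c_{w,\underline{\mathcal C}(x,y)}\circ G\varphi_{Fw,x,y}$ and $\rho_x\circ(x\otimes\varepsilon)$, is a weak tensoring of $G_*\mathcal C$ over $\mathcal W$. If the former is set-compatible (resp. unital), then so is the latter. 3. If $((-)^-,\psi,\eta)$ is a weak cotensoring of $\mathcal C$ over $\mathcal V$, then $y^w:=y^{Fw}$, with the maps $c_{w,\underline{\mathcal C}(x,y)}\circ G\psi_{Fw,x,y}$ and $y^{\varepsilon}\circ\eta_y$, is a weak cotensoring of $G_*\mathcal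 C$ over $\mathcal W$. If the former is set-compatible (resp. unital), then so is the latter. -/

import Mathlib

open CategoryTheory MonoidalCategory Limits Opposite HomotopicalAlgebra

namespace WeakEnrichment

universe v₁ v₂ v₃ u₁ u₂ u₃

section Axioms

variable {A : Type u₁} [Category.{v₁} A] [ModelCategory A]
  {B : Type u₂} [Category.{v₂} B] [ModelCategory B]
  {D : Type u₃} [Category.{v₃} D] [ModelCategory D]

/-- The (external) pushout-product axiom for a bifunctor `T : A × B ⟶ D`: for cofibrations
`i : x ⟶ y` and `k : a ⟶ b`, every pushout-product
`T(y, a) ⨿_{T(x, a)} T(x, b) ⟶ T(y, b)` is a cofibration, acyclic if `i` or `k` is. -/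
def PushoutProductAxiom (T : A ⥤ B ⥤ D) : Prop :=
  ∀ ⦃x y : A⦄ (i : x ⟶ y) ⦃a b : B⦄ (k : a ⟶ b) [Cofibration i] [Cofibration k]
    (sq : T.PushoutObjObj i k),
    Cofibration sq.ι ∧ (WeakEquivalence i ∨ WeakEquivalence k → WeakEquivalence sq.ι)

/-- The pullback-power axiom for a bifunctor `P : Aᵒᵖ × B ⟶ D`: for a cofibration `i : a ⟶ b`
and a fibration `p : x ⟶ y`, every pullback-power
`P(b, x) ⟶ P(a, x) ×_{P(a, y)} P(b, y)` is a fibration, acyclic if `i` or `p` is. -/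
def PullbackPowerAxiom (P : Aᵒᵖ ⥤ B ⥤ D) : Prop :=
  ∀ ⦃a b : A⦄ (i : a ⟶ b) ⦃x y : B⦄ (p : x ⟶ y) [Cofibration i] [Fibration p]
    (sq : P.PullbackObjObj i p),
    Fibration sq.π ∧ (WeakEquivalence i ∨ WeakEquivalence p → WeakEquivalence sq.π)

end Axioms

/-- Compatibility of a model structure with a closed symmetric monoidal structure: the
pushout-product axiom and the unit axiom. Together with the instance arguments this is a
symmetric monoidal model category. -/
class IsSymmetricMonoidalModelCategory (V : Type u₁) [Category.{v₁} V] [MonoidalCategory V]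
    [SymmetricCategory V] [MonoidalClosed V] [ModelCategory V] : Prop where
  pushoutProduct : PushoutProductAxiom (curriedTensor V)
  unit (x : V) [IsCofibrant x] (Q : V) [IsCofibrant Q] (q : Q ⟶ 𝟙_ V) [WeakEquivalence q] :
    WeakEquivalence (x ◁ q ≫ (ρ_ x).hom)

section Enriched

variable (V : Type u₁) [Category.{v₁} V] [MonoidalCategory V] [SymmetricCategory V]
  [MonoidalClosed V] [ModelCategory V]
  (C : Type u₃) [Category.{v₃} C] [ModelCategory C]

/-- A `V`-enriched model category satisfying SM7. Here `C` is a `V`-category whose underlying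
category carries a model structure. The initial and the terminal object of `C` are so in the
enriched sense, and the pullback-power
`C(b, x) ⟶ C(a, x) ×_{C(a, y)} C(b, y)` of a cofibration `a ⟶ b` and a fibration `x ⟶ y` is a
fibration in `V`, acyclic if one of the two maps is. -/
class IsEnrichedModelCategory [EnrichedOrdinaryCategory V C] : Prop where
  isTerminal_hom_initial (y : C) : Nonempty (IsTerminal ((⊥_ C) ⟶[V] y))
  isTerminal_hom_terminal (x : C) : Nonempty (IsTerminal (x ⟶[V] (⊤_ C)))
  sm7 : PullbackPowerAxiom (eHomFunctor V C)

/-- The data underlying a weak tensoring: a bifunctor `(x, v) ↦ x ⊗ v` on ordinary categories, and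
families of maps `φ : C(x ⊗ v, y) ⟶ [v, C(x, y)]` and `ρ : x ⊗ 𝟙 ⟶ x`. -/
structure TensoringData [EnrichedOrdinaryCategory V C] where
  tensor : C ⥤ V ⥤ C
  φ (v : V) (x y : C) : ((tensor.obj x).obj v ⟶[V] y) ⟶ (ihom v).obj (x ⟶[V] y)
  ρ (x : C) : (tensor.obj x).obj (𝟙_ V) ⟶ x

/-- The data underlying a weak cotensoring: a bifunctor `(v, y) ↦ y ^ v` on ordinary categories, and
families of maps `ψ : C(x, y ^ v) ⟶ [v, C(x, y)]` and `η : y ⟶ y ^ 𝟙`. -/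
structure CotensoringData [EnrichedOrdinaryCategory V C] where
  cotensor : Vᵒᵖ ⥤ C ⥤ C
  ψ (v : V) (x y : C) : (x ⟶[V] (cotensor.obj (op v)).obj y) ⟶ (ihom v).obj (x ⟶[V] y)
  η (y : C) : y ⟶ (cotensor.obj (op (𝟙_ V))).obj y

variable {V C}

/-- `T` is a weak tensoring of `C` over `V`. -/
structure TensoringData.IsWeakTensoring [EnrichedOrdinaryCategory V C]
    (T : TensoringData V C) : Prop where
  /-- `∅ ⊗ v` is initial -/
  isInitial_left (v : V) : Nonempty (IsInitial ((T.tensor.obj (⊥_ C)).obj v))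
  /-- `x ⊗ ∅` is initial -/
  isInitial_right (x : C) : Nonempty (IsInitial ((T.tensor.obj x).obj (⊥_ V)))
  pushoutProduct : PushoutProductAxiom T.tensor
  φ_natural_tensor ⦃v v' : V⦄ (f : v ⟶ v') (x y : C) :
    eHomWhiskerRight V ((T.tensor.obj x).map f) y ≫ T.φ v x y =
      T.φ v' x y ≫ (MonoidalClosed.pre f).app (x ⟶[V] y)
  φ_natural_source (v : V) ⦃x x' : C⦄ (g : x ⟶ x') (y : C) :
    eHomWhiskerRight V ((T.tensor.map g).app v) y ≫ T.φ v x y =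
      T.φ v x' y ≫ (ihom v).map (eHomWhiskerRight V g y)
  φ_natural_target (v : V) (x : C) ⦃y y' : C⦄ (h : y ⟶ y') :
    eHomWhiskerLeft V ((T.tensor.obj x).obj v) h ≫ T.φ v x y' =
      T.φ v x y ≫ (ihom v).map (eHomWhiskerLeft V x h)
  φ_weakEquivalence (v : V) (x y : C) [IsCofibrant v] [IsCofibrant x] [IsFibrant y] :
    WeakEquivalence (T.φ v x y)
  ρ_natural ⦃x x' : C⦄ (g : x ⟶ x') :
    (T.tensor.map g).app (𝟙_ V) ≫ T.ρ x' = T.ρ x ≫ g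
  /-- `φ` precomposed with `ρ^*` is the canonical isomorphism `C(x, y) ≅ [𝟙, C(x, y)]`. -/
  ρ_φ (x y : C) :
    eHomWhiskerRight V (T.ρ x) y ≫ T.φ (𝟙_ V) x y =
      MonoidalClosed.curry (λ_ (x ⟶[V] y)).hom

/-- `φ` induces bijections on underlying sets. -/
def TensoringData.SetCompatible [EnrichedOrdinaryCategory V C] (T : TensoringData V C) : Prop :=
  ∀ (v : V) (x y : C), Function.Bijective
    (fun f : 𝟙_ V ⟶ ((T.tensor.obj x).obj v ⟶[V] y) => f ≫ T.φ v x y)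

/-- `ρ` is an isomorphism. -/
def TensoringData.Unital [EnrichedOrdinaryCategory V C] (T : TensoringData V C) : Prop :=
  ∀ x : C, IsIso (T.ρ x)

/-- `P` is a weak cotensoring of `C` over `V`. -/
structure CotensoringData.IsWeakCotensoring [EnrichedOrdinaryCategory V C]
    (P : CotensoringData V C) : Prop where
  /-- `y ^ ∅` is terminal -/
  isTerminal_left (y : C) : Nonempty (IsTerminal ((P.cotensor.obj (op (⊥_ V))).obj y))
  /-- `* ^ v` is terminal -/
  isTerminal_right (v : V) : Nonempty (IsTerminal ((P.cotensor.obj (op v)).obj (⊤_ C)))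
  pullbackPower : PullbackPowerAxiom P.cotensor
  ψ_natural_cotensor ⦃v v' : V⦄ (f : v ⟶ v') (x y : C) :
    eHomWhiskerLeft V x ((P.cotensor.map f.op).app y) ≫ P.ψ v x y =
      P.ψ v' x y ≫ (MonoidalClosed.pre f).app (x ⟶[V] y)
  ψ_natural_source (v : V) ⦃x x' : C⦄ (g : x ⟶ x') (y : C) :
    eHomWhiskerRight V g ((P.cotensor.obj (op v)).obj y) ≫ P.ψ v x y =
      P.ψ v x' y ≫ (ihom v).map (eHomWhiskerRight V g y)
  ψ_natural_target (v : V) (x : C) ⦃y y' : C⦄ (h : y ⟶ y') :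
    eHomWhiskerLeft V x ((P.cotensor.obj (op v)).map h) ≫ P.ψ v x y' =
      P.ψ v x y ≫ (ihom v).map (eHomWhiskerLeft V x h)
  ψ_weakEquivalence (v : V) (x y : C) [IsCofibrant v] [IsCofibrant x] [IsFibrant y] :
    WeakEquivalence (P.ψ v x y)
  η_natural ⦃y y' : C⦄ (h : y ⟶ y') :
    h ≫ P.η y' = P.η y ≫ (P.cotensor.obj (op (𝟙_ V))).map h
  /-- `ψ` precomposed with `η_*` is the canonical isomorphism `C(x, y) ≅ [𝟙, C(x, y)]`. -/
  η_ψ (x y : C) :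
    eHomWhiskerLeft V x (P.η y) ≫ P.ψ (𝟙_ V) x y =
      MonoidalClosed.curry (λ_ (x ⟶[V] y)).hom

/-- `ψ` induces bijections on underlying sets. -/
def CotensoringData.SetCompatible [EnrichedOrdinaryCategory V C] (P : CotensoringData V C) : Prop :=
  ∀ (v : V) (x y : C), Function.Bijective
    (fun f : 𝟙_ V ⟶ (x ⟶[V] (P.cotensor.obj (op v)).obj y) => f ≫ P.ψ v x y)

/-- `η` is an isomorphism. -/
def CotensoringData.Unital [EnrichedOrdinaryCategory V C] (P : CotensoringData V C) : Prop :=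
  ∀ y : C, IsIso (P.η y)

end Enriched

section ChangeOfEnrichment

variable {W : Type u₂} [Category.{v₂} W] [MonoidalCategory W]
  {V : Type u₁} [Category.{v₁} V] [MonoidalCategory V]
  {F : W ⥤ V} {G : V ⥤ W} [F.OplaxMonoidal] [G.LaxMonoidal]

/-- A weak monoidal Quillen adjunction `F ⊣ G`: a Quillen adjunction for which the oplax structure
maps of `F` corresponding to the lax monoidal structure of `G` (the correspondence is
`Adjunction.IsMonoidal`) satisfy the two usual homotopical conditions. -/
class IsWeakMonoidalQuillen [ModelCategory W] [ModelCategory V] (adj : F ⊣ G)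
    [adj.IsMonoidal] : Prop where
  cofibration_map ⦃a b : W⦄ (i : a ⟶ b) [Cofibration i] : Cofibration (F.map i)
  acyclic_map ⦃a b : W⦄ (i : a ⟶ b) [Cofibration i] [WeakEquivalence i] :
    WeakEquivalence (F.map i)
  δ_weakEquivalence (x y : W) [IsCofibrant x] [IsCofibrant y] :
    WeakEquivalence (Functor.OplaxMonoidal.δ F x y)
  /-- for some cofibrant replacement `q` of the unit, `F(q)` followed by the counit
  `F(𝟙) ⟶ 𝟙` is a weak equivalence -/
  unit : ∃ (Q : W) (q : Q ⟶ 𝟙_ W), IsCofibrant Q ∧ WeakEquivalence q ∧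
    WeakEquivalence (F.map q ≫ Functor.OplaxMonoidal.η F)

variable (adj : F ⊣ G) [adj.IsMonoidal] [IsIso (Functor.OplaxMonoidal.η F)]

/-- When `F(𝟙) ⟶ 𝟙` is an isomorphism, `G` preserves underlying sets:
`V(𝟙, v) ≅ V(F(𝟙), v) ≅ W(𝟙, G(v))`. -/
noncomputable def underlyingEquiv (v : V) : (𝟙_ V ⟶ v) ≃ (𝟙_ W ⟶ G.obj v) :=
  (asIso (Functor.OplaxMonoidal.η F)).symm.homFromEquiv.trans (adj.homEquiv (𝟙_ W) v)

lemma underlyingEquiv_apply (v : V) (f : 𝟙_ V ⟶ v) :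
    underlyingEquiv adj v f = Functor.LaxMonoidal.ε G ≫ G.map f := by
  simp [underlyingEquiv, Adjunction.homEquiv_unit, ← adj.unit_app_unit_comp_map_η]

/-- The change of enrichment `G_* C`, with hom-objects `G(C(x, y))`. Its underlying category is
identified with `C` itself. -/
@[reducible]
noncomputable def changeEnrichment (C : Type u₃) [Category.{v₃} C]
    [EnrichedOrdinaryCategory V C] : EnrichedOrdinaryCategory W C :=
  TransportEnrichment.enrichedOrdinaryCategory C G (underlyingEquiv adj) (underlyingEquiv_apply adj)

variable [MonoidalClosed V] [MonoidalClosed W]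

/-- The comparison map `G[F(w), v] ⟶ [w, G(v)]`, adjunct to
`F(w ⊗ G[F(w), v]) ⟶ F(w) ⊗ F(G[F(w), v]) ⟶ F(w) ⊗ [F(w), v] ⟶ v`. -/
noncomputable def homComparison (w : W) (v : V) :
    G.obj ((ihom (F.obj w)).obj v) ⟶ (ihom w).obj (G.obj v) :=
  MonoidalClosed.curry (adj.homEquiv _ _
    (Functor.OplaxMonoidal.δ F w (G.obj ((ihom (F.obj w)).obj v)) ≫
      F.obj w ◁ adj.counit.app ((ihom (F.obj w)).obj v) ≫ (ihom.ev (F.obj w)).app v))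

variable {C : Type u₃} [Category.{v₃} C] [EnrichedOrdinaryCategory V C]

/-- The induced tensoring data on `G_* C`: `x ⊗ w := x ⊗ F(w)`, with structure maps
`G C(x ⊗ F(w), y) ⟶ G[F(w), C(x, y)] ⟶ [w, G C(x, y)]` and `x ⊗ F(𝟙) ⟶ x ⊗ 𝟙 ⟶ x`. -/
noncomputable def TensoringData.change (T : TensoringData V C) :
    letI := changeEnrichment adj C
    TensoringData W C :=
  letI := changeEnrichment adj C
  { tensor := T.tensor ⋙ (Functor.whiskeringLeft W V C).obj F
    φ := fun w x y => G.map (T.φ (F.obj w) x y) ≫ homComparison adj w (x ⟶[V] y)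
    ρ := fun x => (T.tensor.obj x).map (Functor.OplaxMonoidal.η F) ≫ T.ρ x }

/-- The induced cotensoring data on `G_* C`: `y ^ w := y ^ F(w)`, with structure maps
`G C(x, y ^ F(w)) ⟶ G[F(w), C(x, y)] ⟶ [w, G C(x, y)]` and `y ⟶ y ^ 𝟙 ⟶ y ^ F(𝟙)`. -/
noncomputable def CotensoringData.change (P : CotensoringData V C) :
    letI := changeEnrichment adj C
    CotensoringData W C :=
  letI := changeEnrichment adj C
  { cotensor := F.op ⋙ P.cotensor
    ψ := fun w x y => G.map (P.ψ (F.obj w) x y) ≫ homComparison adj w (x ⟶[V] y)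
    η := fun y => P.η y ≫ (P.cotensor.map (Functor.OplaxMonoidal.η F).op).app y }

end ChangeOfEnrichment

end WeakEnrichment

/-!
Write `c : G[F(w), v] ⟶ [w, G(v)]` for the comparison of internal homs. Under the composite
adjunctions, postcomposition with `c` on maps out of `a` is precomposition with
`δ : F(w ⊗ a) ⟶ F(w) ⊗ F(a)` (`homEquiv_symm_uncurry_homComparison`). Everything specific to `c` is
read off from this:

* naturality of `c` is naturality of `δ`;
* left unitality of `F` identifies `c` at `w = 𝟙` with the canonical isomorphisms
  (`map_curry_leftUnitor_homComparison`);
* `c` is bijective on underlying sets, because `δ` at `a = 𝟙` is invertible by right unitality when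
  `F(𝟙) ⟶ 𝟙` is (`bijective_comp_homComparison`);
* `c` is a weak equivalence for cofibrant `w` and fibrant `v` (`weakEquivalence_homComparison`).

The last point holds for any natural transformation `L ⟶ L'` of left Quillen functors which is a
weak equivalence on cofibrant objects: its conjugate on right adjoints is a weak equivalence on
fibrant objects (`IsLeftQuillen.weakEquivalence_of_conjugate`). Left Quillen functors preserve good
cylinders on cofibrant objects, so transposition respects homotopy and the conjugate induces
bijections on homotopy classes of maps out of cofibrant objects; between fibrant objects this forces
a weak equivalence (`BijectiveOnHomotopyClasses.weakEquivalence`).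

The remaining axioms are transported: a right Quillen functor preserves pullback-powers, hence SM7;
restricting the variable in `V` along the left Quillen functor `F` preserves the pushout-product and
pullback-power axioms; and `G(φ)` is a weak equivalence by Ken Brown's lemma, as SM7 and the
pushout-product axiom in `V` make its source and target fibrant.
-/

namespace WeakEnrichment

universe v₁ v₂ v₃ u₁ u₂ u₃


/-! ### Detecting weak equivalences by homotopy classes -/

section Detection

variable {A : Type u₁} [Category.{v₁} A] [ModelCategory A]

lemma exists_cofibrant_replacement (X : A) :
    ∃ (X' : A) (r : X' ⟶ X), IsCofibrant X' ∧ Fibration r ∧ WeakEquivalence r := by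
  let h := MorphismProperty.factorizationData (cofibrations A) (trivialFibrations A) (initial.to X)
  refine ⟨h.Z, h.p, ?_, inferInstance, inferInstance⟩
  rw [isCofibrant_iff, Subsingleton.elim (initial.to h.Z) h.i]
  infer_instance

lemma weakEquivalence_of_leftHomotopyRel {X Y : A} {f g : X ⟶ Y} (h : LeftHomotopyRel f g)
    [hg : WeakEquivalence g] : WeakEquivalence f := by
  obtain ⟨P, ⟨h⟩⟩ := h
  exact h.weakEquivalence_iff.2 hg

/-- `f` induces bijections on left homotopy classes of maps out of cofibrant objects. -/
structure BijectiveOnHomotopyClasses {X Y : A} (f : X ⟶ Y) : Prop where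
  surjective ⦃K : A⦄ [IsCofibrant K] (y : K ⟶ Y) : ∃ x : K ⟶ X, LeftHomotopyRel (x ≫ f) y
  injective ⦃K : A⦄ [IsCofibrant K] (x x' : K ⟶ X) (h : LeftHomotopyRel (x ≫ f) (x' ≫ f)) :
    LeftHomotopyRel x x'

namespace BijectiveOnHomotopyClasses

variable {X Y : A} {f : X ⟶ Y}

/-- Surjectivity holds up to homotopy, and strictly for a fibration by covering homotopy. -/
lemma exists_lift (hf : BijectiveOnHomotopyClasses f) [Fibration f] {K : A} [IsCofibrant K]
    (y : K ⟶ Y) : ∃ x : K ⟶ X, x ≫ f = y := by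
  obtain ⟨x, hx⟩ := hf.surjective y
  obtain ⟨P, _, ⟨h⟩⟩ := hx.exists_good_cylinder
  obtain ⟨x', h', e⟩ := h.covering_homotopy f x
  exact ⟨x', by rw [← h'.h₁, Category.assoc, e, h.h₁]⟩

/-- A section `s` of `f` exists, and `f ≫ s` is a weak equivalence because it is homotopic to the
identity after restriction to a cofibrant replacement; `f` is a retract of `f ≫ s`. -/
lemma weakEquivalence_of_isCofibrant (hf : BijectiveOnHomotopyClasses f) [Fibration f]
    [IsCofibrant Y] : WeakEquivalence f := by
  obtain ⟨s, hs⟩ := hf.exists_lift (𝟙 Y)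
  obtain ⟨X', r, _, _, _⟩ := exists_cofibrant_replacement X
  have h : LeftHomotopyRel (r ≫ f ≫ s) r :=
    hf.injective _ _ (by simpa [hs] using LeftHomotopyRel.refl (r ≫ f))
  have := weakEquivalence_of_leftHomotopyRel h
  have : WeakEquivalence (f ≫ s) := weakEquivalence_of_precomp r _
  let ret : RetractArrow f (f ≫ s) :=
    { i := Arrow.homMk (𝟙 X) s
      r := Arrow.homMk (𝟙 X) f
      retract := by ext <;> simp [hs] }
  rw [weakEquivalence_iff] at this ⊢
  exact MorphismProperty.of_retract ret this

/-- Pulling `f` back along a cofibrant replacement of `Y` reduces to the case of cofibrant `Y`. -/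
lemma weakEquivalence_of_fibration (hf : BijectiveOnHomotopyClasses f) [Fibration f] :
    WeakEquivalence f := by
  obtain ⟨Y', q, _, _, _⟩ := exists_cofibrant_replacement Y
  have h : BijectiveOnHomotopyClasses (pullback.snd f q) :=
    { surjective := fun K _ y ↦ by
        obtain ⟨x, hx⟩ := hf.exists_lift (y ≫ q)
        exact ⟨pullback.lift x y hx, by rw [pullback.lift_snd]; exact .refl y⟩
      injective := fun K _ z z' hz ↦ by
        have h₁ := hf.injective (z ≫ pullback.fst f q) (z' ≫ pullback.fst f q)
          (by simpa [pullback.condition] using hz.postcomp q)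
        rw [← LeftHomotopyClass.mk_eq_mk_iff] at h₁ ⊢
        exact (LeftHomotopyClass.postcomp_bijective_of_fibration_of_weakEquivalence K
          (pullback.fst f q)).1 (by simpa using h₁) }
  have := h.weakEquivalence_of_isCofibrant
  have : WeakEquivalence (pullback.fst f q ≫ f) := by
    rw [pullback.condition]; infer_instance
  exact weakEquivalence_of_precomp (pullback.fst f q) f

/-- A map between fibrant objects which induces bijections on homotopy classes of maps out of all
cofibrant objects is a weak equivalence. -/
theorem weakEquivalence (hf : BijectiveOnHomotopyClasses f) [IsFibrant X] [IsFibrant Y] :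
    WeakEquivalence f := by
  let d := MorphismProperty.factorizationData (trivialCofibrations A) (fibrations A) f
  have : IsFibrant d.Z := isFibrant_of_fibration d.p
  have h : BijectiveOnHomotopyClasses d.p :=
    { surjective := fun K _ y ↦ by
        obtain ⟨x, hx⟩ := hf.surjective y
        exact ⟨x ≫ d.i, by simpa using hx⟩
      injective := fun K _ z z' hz ↦ by
        have hi := LeftHomotopyClass.postcomp_bijective_of_weakEquivalence K d.i
        have key (z : K ⟶ d.Z) : ∃ x : K ⟶ X, LeftHomotopyRel (x ≫ d.i) z := by
          obtain ⟨x, hx⟩ := hi.2 (.mk z)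
          obtain ⟨x, rfl⟩ := x.mk_surjective
          exact ⟨x, by simpa [LeftHomotopyClass.mk_eq_mk_iff] using hx⟩
        obtain ⟨x, hx⟩ := key z
        obtain ⟨x', hx'⟩ := key z'
        have h₁ : LeftHomotopyRel x x' := hf.injective _ _ (by
          simpa using ((hx.postcomp d.p).trans hz).trans (hx'.postcomp d.p).symm)
        exact (hx.symm.trans (h₁.postcomp d.i)).trans hx' }
  have := h.weakEquivalence_of_fibration
  rw [← d.fac]
  infer_instance

end BijectiveOnHomotopyClasses

end Detection

/-! ### Left Quillen functors -/

section Quillen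

variable {A : Type u₁} [Category.{v₁} A] [ModelCategory A]
  {B : Type u₂} [Category.{v₂} B] [ModelCategory B]
  {D : Type u₃} [Category.{v₃} D] [ModelCategory D]

/-- `L` preserves cofibrations and acyclic cofibrations. The existence of a right adjoint is not
part of the definition. -/
structure IsLeftQuillen (L : A ⥤ B) : Prop where
  cofibration_map ⦃a b : A⦄ (i : a ⟶ b) [Cofibration i] : Cofibration (L.map i)
  acyclic_map ⦃a b : A⦄ (i : a ⟶ b) [Cofibration i] [WeakEquivalence i] :
    WeakEquivalence (L.map i)

namespace IsLeftQuillen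

lemma comp {L : A ⥤ B} {L' : B ⥤ D} (hL : IsLeftQuillen L) (hL' : IsLeftQuillen L') :
    IsLeftQuillen (L ⋙ L') where
  cofibration_map _ _ i _ :=
    have := hL.cofibration_map i
    hL'.cofibration_map (L.map i)
  acyclic_map _ _ i _ _ :=
    have := hL.cofibration_map i
    have := hL.acyclic_map i
    hL'.acyclic_map (L.map i)

variable {L : A ⥤ B} {R : B ⥤ A}

lemma fibration_map (hL : IsLeftQuillen L) (adj : L ⊣ R) {x y : B} (p : x ⟶ y) [Fibration p] :
    Fibration (R.map p) := by
  rw [fibration_iff, ← trivialCofibrations_rlp]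
  intro a b i hi
  rw [mem_trivialCofibrations_iff] at hi
  obtain ⟨_, _⟩ := hi
  have := hL.cofibration_map i
  have := hL.acyclic_map i
  rw [← adj.hasLiftingProperty_iff]
  infer_instance

lemma acyclic_fibration_map (hL : IsLeftQuillen L) (adj : L ⊣ R) {x y : B} (p : x ⟶ y)
    [Fibration p] [WeakEquivalence p] : WeakEquivalence (R.map p) := by
  suffices h : trivialFibrations A (R.map p) from (weakEquivalence_iff _).2 h.2
  rw [← cofibrations_rlp]
  intro a b i hi
  rw [← cofibration_iff] at hi
  have := hL.cofibration_map i
  rw [← adj.hasLiftingProperty_iff]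
  infer_instance

lemma isFibrant_obj (hL : IsLeftQuillen L) (adj : L ⊣ R) (x : B) [IsFibrant x] :
    IsFibrant (R.obj x) := by
  have := adj.rightAdjoint_preservesLimits
  rw [isFibrant_iff_of_isTerminal (R.map (terminal.from x))
    (IsTerminal.isTerminalObj R _ terminalIsTerminal)]
  exact hL.fibration_map adj _

lemma isCofibrant_obj (hL : IsLeftQuillen L) (adj : L ⊣ R) (a : A) [IsCofibrant a] :
    IsCofibrant (L.obj a) := by
  have := adj.leftAdjoint_preservesColimits
  rw [isCofibrant_iff_of_isInitial (L.map (initial.to a))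
    (IsInitial.isInitialObj L _ initialIsInitial)]
  exact hL.cofibration_map _

/-- Ken Brown's lemma for right Quillen functors. -/
lemma weakEquivalence_map (hL : IsLeftQuillen L) (adj : L ⊣ R) {x y : B} (f : x ⟶ y)
    [IsFibrant x] [IsFibrant y] [WeakEquivalence f] : WeakEquivalence (R.map f) := by
  let h : FibrantBrownFactorization f := Classical.arbitrary _
  have := hL.acyclic_fibration_map adj h.r
  have := hL.acyclic_fibration_map adj h.p
  have e : R.map h.i ≫ R.map h.r = 𝟙 _ := by rw [← R.map_comp, h.i_r, R.map_id]
  have : WeakEquivalence (R.map h.i) := weakEquivalence_of_postcomp_of_fac e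
  rw [← h.fac, R.map_comp]
  infer_instance

/-- The image of a good cylinder under a left Quillen functor. The projection stays a weak
equivalence because it has an acyclic cofibration as a section. -/
def mapCylinder (hL : IsLeftQuillen L) {a : A} [IsCofibrant a] (P : Cylinder a) [P.IsGood] :
    Cylinder (L.obj a) where
  __ := P.toPrecylinder.map L
  weakEquivalence_π := by
    have : WeakEquivalence (L.map P.i₀) := hL.acyclic_map P.i₀
    have e : L.map P.i₀ ≫ L.map P.π = 𝟙 _ := by rw [← L.map_comp, P.i₀_π, L.map_id]
    have h : WeakEquivalence (L.map P.π) := weakEquivalence_of_precomp_of_fac e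
    exact h

lemma isGood_mapCylinder (hL : IsLeftQuillen L) (adj : L ⊣ R) {a : A} [IsCofibrant a]
    (P : Cylinder a) [P.IsGood] : (hL.mapCylinder P).IsGood where
  cofibration_i := by
    have := adj.leftAdjoint_preservesColimits
    have e : coprod.desc (L.map P.i₀) (L.map P.i₁) =
        (PreservesColimitPair.iso L a a).hom ≫ L.map P.i := by
      apply coprod.hom_ext
      · rw [coprod.inl_desc, PreservesColimitPair.iso_hom, coprodComparison,
          coprod.inl_desc_assoc, ← L.map_comp, Precylinder.inl_i]
      · rw [coprod.inr_desc, PreservesColimitPair.iso_hom, coprodComparison,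
          coprod.inr_desc_assoc, ← L.map_comp, Precylinder.inr_i]
    have : Cofibration (L.map P.i) := hL.cofibration_map P.i
    have h : Cofibration (coprod.desc (L.map P.i₀) (L.map P.i₁)) := by
      rw [e]
      infer_instance
    exact h

/-- Transposition along a Quillen adjunction respects homotopy of maps from a cofibrant to a
fibrant object. -/
lemma leftHomotopyRel_homEquiv_iff (hL : IsLeftQuillen L) (adj : L ⊣ R) {a : A} [IsCofibrant a]
    {x : B} [IsFibrant x] (f g : L.obj a ⟶ x) :
    LeftHomotopyRel (adj.homEquiv _ _ f) (adj.homEquiv _ _ g) ↔ LeftHomotopyRel f g := by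
  constructor
  · intro h
    obtain ⟨P, _, ⟨h⟩⟩ := h.exists_good_cylinder
    refine ⟨hL.mapCylinder P, ⟨{ h := (adj.homEquiv _ _).symm h.h, h₀ := ?_, h₁ := ?_ }⟩⟩
    · exact (adj.homEquiv_naturality_left_symm P.i₀ h.h).symm.trans (by rw [h.h₀]; simp)
    · exact (adj.homEquiv_naturality_left_symm P.i₁ h.h).symm.trans (by rw [h.h₁]; simp)
  · intro h
    have := hL.isCofibrant_obj adj a
    obtain ⟨P, _⟩ := Cylinder.exists_very_good a
    have := hL.isGood_mapCylinder adj P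
    have h := h.leftHomotopy (hL.mapCylinder P)
    refine ⟨P, ⟨{ h := adj.homEquiv _ _ h.h, h₀ := ?_, h₁ := ?_ }⟩⟩
    · exact (adj.homEquiv_naturality_left P.i₀ h.h).symm.trans (congrArg _ h.h₀)
    · exact (adj.homEquiv_naturality_left P.i₁ h.h).symm.trans (congrArg _ h.h₁)

/-- If `α : L ⟶ L'` is a natural transformation of left Quillen functors which is a weak
equivalence on cofibrant objects, then the conjugate `c : R'(x) ⟶ R(x)` on right adjoints is a weak
equivalence for fibrant `x`: on homotopy classes of maps out of a cofibrant object `a` it is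
precomposition with `α_a : L(a) ⟶ L'(a)`. -/
theorem weakEquivalence_of_conjugate {L' : A ⥤ B} {R' : B ⥤ A} (hL : IsLeftQuillen L)
    (hL' : IsLeftQuillen L') (adj : L ⊣ R) (adj' : L' ⊣ R') (α : ∀ a, L.obj a ⟶ L'.obj a)
    (hα : ∀ (a : A) [IsCofibrant a], WeakEquivalence (α a)) {x : B} [IsFibrant x]
    (c : R'.obj x ⟶ R.obj x)
    (hc : ∀ {a : A} (g : L'.obj a ⟶ x),
      adj'.homEquiv _ _ g ≫ c = adj.homEquiv _ _ (α a ≫ g)) :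
    WeakEquivalence c := by
  have := hL.isFibrant_obj adj x
  have := hL'.isFibrant_obj adj' x
  refine BijectiveOnHomotopyClasses.weakEquivalence ⟨fun a _ y ↦ ?_, fun a _ z z' h ↦ ?_⟩ <;>
    have := hL.isCofibrant_obj adj a <;>
    have := hL'.isCofibrant_obj adj' a <;>
    have := hα a <;>
    have bij := RightHomotopyClass.precomp_bijective_of_weakEquivalence x (α a)
  · obtain ⟨y, rfl⟩ := (adj.homEquiv _ _).surjective y
    obtain ⟨g, hg⟩ := bij.2 (.mk y)
    obtain ⟨g, rfl⟩ := g.mk_surjective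
    dsimp only at hg
    rw [RightHomotopyClass.precomp_mk, RightHomotopyClass.mk_eq_mk_iff,
      ← leftHomotopyRel_iff_rightHomotopyRel] at hg
    exact ⟨adj'.homEquiv _ _ g, by rwa [hc, hL.leftHomotopyRel_homEquiv_iff]⟩
  · obtain ⟨g, rfl⟩ := (adj'.homEquiv _ _).surjective z
    obtain ⟨g', rfl⟩ := (adj'.homEquiv _ _).surjective z'
    rw [hc, hc, hL.leftHomotopyRel_homEquiv_iff, leftHomotopyRel_iff_rightHomotopyRel,
      ← RightHomotopyClass.mk_eq_mk_iff] at h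
    rw [hL'.leftHomotopyRel_homEquiv_iff, leftHomotopyRel_iff_rightHomotopyRel,
      ← RightHomotopyClass.mk_eq_mk_iff]
    exact bij.1 h

end IsLeftQuillen

end Quillen


/-! ### Pushout-products and pullback-powers with a cofibrant object -/

section Bifunctors

variable {A : Type u₁} [Category.{v₁} A] [ModelCategory A]
  {B : Type u₂} [Category.{v₂} B] [ModelCategory B]
  {D : Type u₃} [Category.{v₃} D] [ModelCategory D]

/-- The pushout-product of `∅ ⟶ x` and `k : a ⟶ b` is `T(x, k)`. -/
lemma PushoutProductAxiom.isLeftQuillen {T : A ⥤ B ⥤ D} (hT : PushoutProductAxiom T)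
    (h₀ : ∀ b : B, Nonempty (IsInitial ((T.obj (⊥_ A)).obj b))) (x : A) [IsCofibrant x] :
    IsLeftQuillen (T.obj x) := by
  have key {a b : B} (k : a ⟶ b) [Cofibration k] :
      Cofibration ((T.obj x).map k) ∧ (WeakEquivalence k → WeakEquivalence ((T.obj x).map k)) := by
    obtain ⟨ha⟩ := h₀ a
    obtain ⟨hb⟩ := h₀ b
    have : IsIso ((T.obj (⊥_ A)).map k) := isIso_of_isInitial ha hb _
    let sq : T.PushoutObjObj (initial.to x) k :=
      { pt := (T.obj x).obj a
        inl := 𝟙 _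
        inr := hb.to _
        isPushout := IsPushout.of_vert_isIso ⟨ha.hom_ext _ _⟩
        ι := (T.obj x).map k
        inl_ι := Category.id_comp _
        inr_ι := hb.hom_ext _ _ }
    have h := hT (initial.to x) k sq
    exact ⟨h.1, fun hk ↦ h.2 (.inr hk)⟩
  exact ⟨fun _ _ k _ ↦ (key k).1, fun _ _ k _ hk ↦ (key k).2 hk⟩

/-- The pullback-power of `∅ ⟶ a` and `y ⟶ *` is `P(a, y) ⟶ *`. -/
lemma PullbackPowerAxiom.isFibrant_obj {P : Aᵒᵖ ⥤ B ⥤ D} (hP : PullbackPowerAxiom P)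
    (h₀ : ∀ y : B, Nonempty (IsTerminal ((P.obj (op (⊥_ A))).obj y)))
    (h₁ : ∀ a : A, Nonempty (IsTerminal ((P.obj (op a)).obj (⊤_ B))))
    (a : A) [IsCofibrant a] (y : B) [IsFibrant y] : IsFibrant ((P.obj (op a)).obj y) := by
  obtain ⟨hy⟩ := h₀ y
  obtain ⟨ht⟩ := h₀ (⊤_ B)
  obtain ⟨ha⟩ := h₁ a
  have : IsIso ((P.obj (op (⊥_ A))).map (terminal.from y)) := isIso_of_isTerminal hy ht _
  let sq : P.PullbackObjObj (initial.to a) (terminal.from y) :=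
    { pt := (P.obj (op a)).obj (⊤_ B)
      fst := hy.from _
      snd := 𝟙 _
      isPullback := IsPullback.of_vert_isIso ⟨ht.hom_ext _ _⟩
      π := (P.obj (op a)).map (terminal.from y)
      π_fst := hy.hom_ext _ _
      π_snd := Category.comp_id _ }
  rw [isFibrant_iff_of_isTerminal ((P.obj (op a)).map (terminal.from y)) ha]
  exact (hP (initial.to a) (terminal.from y) sq).1

/-- Restriction along a left Quillen functor preserves the pushout-product axiom. -/
lemma PushoutProductAxiom.comp_isLeftQuillen {B' : Type*} [Category B'] [ModelCategory B']
    {T : A ⥤ B ⥤ D} (hT : PushoutProductAxiom T) {L : B' ⥤ B} (hL : IsLeftQuillen L) :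
    PushoutProductAxiom (T ⋙ (Functor.whiskeringLeft B' B D).obj L) := by
  intro x y i a b k _ _ sq
  have := hL.cofibration_map k
  let sq' : T.PushoutObjObj i (L.map k) :=
    { pt := sq.pt, inl := sq.inl, inr := sq.inr, isPushout := sq.isPushout
      ι := sq.ι, inl_ι := sq.inl_ι, inr_ι := sq.inr_ι }
  have h := hT i (L.map k) sq'
  exact ⟨h.1, fun hw ↦ h.2 (hw.imp id fun (_ : WeakEquivalence k) ↦ hL.acyclic_map k)⟩

lemma PullbackPowerAxiom.comp_isLeftQuillen {A' : Type*} [Category A'] [ModelCategory A']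
    {P : Aᵒᵖ ⥤ B ⥤ D} (hP : PullbackPowerAxiom P) {L : A' ⥤ A} (hL : IsLeftQuillen L) :
    PullbackPowerAxiom (L.op ⋙ P) := by
  intro a b i x y p _ _ sq
  have := hL.cofibration_map i
  let sq' : P.PullbackObjObj (L.map i) p :=
    { pt := sq.pt, fst := sq.fst, snd := sq.snd, isPullback := sq.isPullback
      π := sq.π, π_fst := sq.π_fst, π_snd := sq.π_snd }
  have h := hP (L.map i) p sq'
  exact ⟨h.1, fun hw ↦ h.2 (hw.imp (fun (_ : WeakEquivalence i) ↦ hL.acyclic_map i) id)⟩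

/-- Postcomposition with a right Quillen functor preserves the pullback-power axiom. -/
lemma PullbackPowerAxiom.comp_rightAdjoint {D' : Type*} [Category D'] [ModelCategory D']
    {P : Aᵒᵖ ⥤ B ⥤ D} (hP : PullbackPowerAxiom P) {L : D' ⥤ D} {R : D ⥤ D'} (adj : L ⊣ R)
    (hL : IsLeftQuillen L) :
    PullbackPowerAxiom (P ⋙ (Functor.whiskeringRight B D D').obj R) := by
  intro a b i x y p _ _ sq
  have := adj.rightAdjoint_preservesLimits
  let sq' : P.PullbackObjObj i p := Functor.PullbackObjObj.ofHasPullback P i p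
  have hpb := sq'.isPullback.map R
  -- the given pullback is isomorphic to the image under `R` of the pullback in `D`
  let e : R.obj sq'.pt ≅ sq.pt := hpb.isoIsPullback _ _ sq.isPullback
  have e₁ : e.hom ≫ sq.fst = R.map sq'.fst := hpb.isoIsPullback_hom_fst _ _ sq.isPullback
  have e₂ : e.hom ≫ sq.snd = R.map sq'.snd := hpb.isoIsPullback_hom_snd _ _ sq.isPullback
  have he : sq.π = R.map sq'.π ≫ e.hom := by
    apply sq.hom_ext
    · rw [sq.π_fst, Category.assoc, e₁, ← R.map_comp, sq'.π_fst]
      rfl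
    · rw [sq.π_snd, Category.assoc, e₂, ← R.map_comp, sq'.π_snd]
      rfl
  have h := hP i p sq'
  have := h.1
  have := hL.fibration_map adj sq'.π
  rw [he]
  refine ⟨inferInstance, fun hw ↦ ?_⟩
  have := h.2 hw
  have := hL.acyclic_fibration_map adj sq'.π
  infer_instance

end Bifunctors

section Monoidal

variable {V : Type u₁} [Category.{v₁} V] [MonoidalCategory V] [SymmetricCategory V]
  [MonoidalClosed V] [ModelCategory V] [IsSymmetricMonoidalModelCategory V]

lemma isLeftQuillen_tensorLeft (v : V) [IsCofibrant v] : IsLeftQuillen (tensorLeft v) :=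
  (IsSymmetricMonoidalModelCategory.pushoutProduct (V := V)).isLeftQuillen
    (fun b ↦ ⟨(IsInitial.isInitialObj (tensorLeft b) _ initialIsInitial).ofIso (β_ b (⊥_ V))⟩) v

lemma isFibrant_ihom (v : V) [IsCofibrant v] (x : V) [IsFibrant x] :
    IsFibrant ((ihom v).obj x) :=
  (isLeftQuillen_tensorLeft v).isFibrant_obj (ihom.adjunction v) x

end Monoidal

/-! ### The comparison of internal homs -/

section Comparison

open Functor.OplaxMonoidal

variable {W : Type u₂} [Category.{v₂} W] {V : Type u₁} [Category.{v₁} V]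
  {F : W ⥤ V} {G : V ⥤ W} (adj : F ⊣ G)

lemma homEquiv_symm_map {v v' : V} (f : v ⟶ v') :
    (adj.homEquiv _ _).symm (G.map f) = adj.counit.app v ≫ f := by
  rw [Adjunction.homEquiv_counit, adj.counit_naturality]

variable [MonoidalCategory W] [MonoidalClosed W]

/-- Maps into `[w, G(v)]` are determined by their transposes `F(w ⊗ a) ⟶ v`. -/
lemma homEquiv_symm_uncurry_injective {a w : W} {v : V} {g g' : a ⟶ (ihom w).obj (G.obj v)}
    (h : (adj.homEquiv _ _).symm (MonoidalClosed.uncurry g) =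
      (adj.homEquiv _ _).symm (MonoidalClosed.uncurry g')) : g = g' :=
  MonoidalClosed.uncurry_injective ((adj.homEquiv _ _).symm.injective h)

variable [MonoidalCategory V] [MonoidalClosed V] [F.OplaxMonoidal]

/-- The comparison `G[F(w), v] ⟶ [w, G(v)]` is conjugate to `δ : F(w ⊗ a) ⟶ F(w) ⊗ F(a)`. -/
lemma homEquiv_symm_uncurry_homComparison {a w : W} {v : V}
    (g : a ⟶ G.obj ((ihom (F.obj w)).obj v)) :
    (adj.homEquiv _ _).symm (MonoidalClosed.uncurry (g ≫ homComparison adj w v)) =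
      δ F w a ≫ MonoidalClosed.uncurry ((adj.homEquiv _ _).symm g) := by
  rw [homComparison, MonoidalClosed.uncurry_natural_left, MonoidalClosed.uncurry_curry,
    adj.homEquiv_naturality_left_symm, Equiv.symm_apply_apply, ← δ_natural_right_assoc,
    MonoidalClosed.uncurry_eq, Adjunction.homEquiv_counit, MonoidalCategory.whiskerLeft_comp,
    Category.assoc]

lemma homComparison_naturality_right (w : W) {v v' : V} (f : v ⟶ v') :
    G.map ((ihom (F.obj w)).map f) ≫ homComparison adj w v' =
      homComparison adj w v ≫ (ihom w).map (G.map f) := by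
  apply homEquiv_symm_uncurry_injective adj
  rw [homEquiv_symm_uncurry_homComparison, MonoidalClosed.uncurry_natural_right,
    adj.homEquiv_naturality_right_symm, ← Category.id_comp (homComparison adj w v),
    homEquiv_symm_uncurry_homComparison, Category.assoc, ← MonoidalClosed.uncurry_natural_right,
    ← adj.homEquiv_naturality_right_symm, Category.id_comp]

lemma homComparison_naturality_left {w w' : W} (f : w ⟶ w') (v : V) :
    G.map ((MonoidalClosed.pre (F.map f)).app v) ≫ homComparison adj w v =
      homComparison adj w' v ≫ (MonoidalClosed.pre f).app (G.obj v) := by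
  apply homEquiv_symm_uncurry_injective adj
  rw [homEquiv_symm_uncurry_homComparison, MonoidalClosed.uncurry_pre_app,
    adj.homEquiv_naturality_left_symm, ← Category.id_comp (homComparison adj w' v),
    homEquiv_symm_uncurry_homComparison, ← δ_natural_left_assoc,
    ← MonoidalClosed.uncurry_pre_app, homEquiv_symm_map, Adjunction.homEquiv_counit,
    F.map_id, Category.id_comp]

/-- By left unitality of the oplax structure, the comparison at the unit identifies the canonical
isomorphisms `v ≅ [𝟙, v]` and `G(v) ≅ [𝟙, G(v)]`. -/
lemma map_curry_leftUnitor_homComparison (v : V) :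
    G.map (MonoidalClosed.curry (λ_ v).hom ≫ (MonoidalClosed.pre (η F)).app v) ≫
      homComparison adj (𝟙_ W) v = MonoidalClosed.curry (λ_ (G.obj v)).hom := by
  apply homEquiv_symm_uncurry_injective adj
  rw [homEquiv_symm_uncurry_homComparison, MonoidalClosed.uncurry_curry, homEquiv_symm_map,
    ← Category.assoc, MonoidalClosed.uncurry_pre_app, MonoidalClosed.uncurry_natural_left,
    MonoidalClosed.uncurry_curry,
    leftUnitor_naturality, left_unitality_hom_assoc, Adjunction.homEquiv_counit]

/-- On underlying sets the comparison is a bijection: `δ : F(w ⊗ 𝟙) ⟶ F(w) ⊗ F(𝟙)` is invertible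
when `F(𝟙) ⟶ 𝟙` is. -/
lemma bijective_comp_homComparison [IsIso (η F)] (w : W) (v : V) :
    Function.Bijective (fun g : 𝟙_ W ⟶ G.obj ((ihom (F.obj w)).obj v) ↦
      g ≫ homComparison adj w v) := by
  have : IsIso (δ F w (𝟙_ W)) := by
    have h : δ F w (𝟙_ W) ≫ F.obj w ◁ η F ≫ (ρ_ _).hom = F.map (ρ_ w).hom :=
      right_unitality_hom F w
    have : IsIso (δ F w (𝟙_ W) ≫ F.obj w ◁ η F ≫ (ρ_ _).hom) := by rw [h]; infer_instance
    exact IsIso.of_isIso_comp_right _ (F.obj w ◁ η F ≫ (ρ_ (F.obj w)).hom)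
  let e : (𝟙_ W ⟶ (ihom w).obj (G.obj v)) ≃ (F.obj (w ⊗ 𝟙_ W) ⟶ v) :=
    ((ihom.adjunction w).homEquiv _ _).symm.trans (adj.homEquiv _ _).symm
  let e' : (𝟙_ W ⟶ G.obj ((ihom (F.obj w)).obj v)) ≃ (F.obj (w ⊗ 𝟙_ W) ⟶ v) :=
    ((adj.homEquiv _ _).symm.trans ((ihom.adjunction (F.obj w)).homEquiv _ _).symm).trans
      (asIso (δ F w (𝟙_ W))).symm.homFromEquiv
  rw [← Function.Bijective.of_comp_iff' e.bijective]
  convert! e'.bijective using 1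
  ext g
  exact homEquiv_symm_uncurry_homComparison adj g

/-- If `φ : h ⟶ [F(w), v]` is bijective on underlying sets, then so is `G(h) ⟶ [w, G(v)]`. -/
lemma bijective_comp_map_comp_homComparison [G.LaxMonoidal] [adj.IsMonoidal] [IsIso (η F)] {w : W}
    {h v : V} (φ : h ⟶ (ihom (F.obj w)).obj v)
    (hφ : Function.Bijective (fun f : 𝟙_ V ⟶ h ↦ f ≫ φ)) :
    Function.Bijective (fun f : 𝟙_ W ⟶ G.obj h ↦ f ≫ G.map φ ≫ homComparison adj w v) := by
  have key : Function.Bijective (fun f : 𝟙_ W ⟶ G.obj h ↦ f ≫ G.map φ) := by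
    rw [← Function.Bijective.of_comp_iff _ (underlyingEquiv adj h).bijective]
    convert! (underlyingEquiv adj _).bijective.comp hφ using 1
    ext f
    simp [underlyingEquiv_apply]
  convert! (bijective_comp_homComparison adj w v).comp key using 1
  ext f
  simp

end Comparison


/-! ### Change of enrichment -/

section Enrichment

variable {W : Type u₂} [Category.{v₂} W] [MonoidalCategory W]
  {V : Type u₁} [Category.{v₁} V] [MonoidalCategory V]
  {F : W ⥤ V} {G : V ⥤ W} [F.OplaxMonoidal] [G.LaxMonoidal] (adj : F ⊣ G) [adj.IsMonoidal]

lemma IsWeakMonoidalQuillen.isLeftQuillen [ModelCategory W] [ModelCategory V]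
    [IsWeakMonoidalQuillen adj] : IsLeftQuillen F where
  cofibration_map _ _ i _ := cofibration_map adj i
  acyclic_map _ _ i _ _ := acyclic_map adj i

variable [IsIso (Functor.OplaxMonoidal.η F)]
  {C : Type u₃} [Category.{v₃} C] [EnrichedOrdinaryCategory V C]

lemma eHomEquiv_changeEnrichment {x y : C} (f : x ⟶ y) :
    letI := changeEnrichment adj C
    eHomEquiv W f = Functor.LaxMonoidal.ε G ≫ G.map (eHomEquiv V f) :=
  underlyingEquiv_apply adj _ _

lemma eHomWhiskerRight_changeEnrichment {x x' : C} (f : x ⟶ x') (y : C) :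
    letI := changeEnrichment adj C
    eHomWhiskerRight W f y = G.map (eHomWhiskerRight V f y) := by
  let := changeEnrichment adj C
  have h : eHomWhiskerRight W f y = (λ_ (G.obj (x' ⟶[V] y))).inv ≫
      (Functor.LaxMonoidal.ε G ≫ G.map (eHomEquiv V f)) ▷ _ ≫
        Functor.LaxMonoidal.μ G _ _ ≫ G.map (eComp V x x' y) := by
    rw [← eHomEquiv_changeEnrichment adj f]
    rfl
  rw [h, comp_whiskerRight_assoc, Functor.LaxMonoidal.μ_natural_left_assoc,
    Functor.LaxMonoidal.left_unitality_inv_assoc, ← G.map_comp, ← G.map_comp]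
  rfl

lemma eHomWhiskerLeft_changeEnrichment (x : C) {y y' : C} (f : y ⟶ y') :
    letI := changeEnrichment adj C
    eHomWhiskerLeft W x f = G.map (eHomWhiskerLeft V x f) := by
  let := changeEnrichment adj C
  have h : eHomWhiskerLeft W x f = (ρ_ (G.obj (x ⟶[V] y))).inv ≫
      _ ◁ (Functor.LaxMonoidal.ε G ≫ G.map (eHomEquiv V f)) ≫
        Functor.LaxMonoidal.μ G _ _ ≫ G.map (eComp V x y y') := by
    rw [← eHomEquiv_changeEnrichment adj f]
    rfl
  rw [h, MonoidalCategory.whiskerLeft_comp_assoc, Functor.LaxMonoidal.μ_natural_right_assoc,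
    Functor.LaxMonoidal.right_unitality_inv_assoc, ← G.map_comp, ← G.map_comp]
  rfl

/-- The enriched hom bifunctor of `G_* C` is that of `C` followed by `G`. -/
lemma eHomFunctor_changeEnrichment :
    letI := changeEnrichment adj C
    eHomFunctor W C = eHomFunctor V C ⋙ (Functor.whiskeringRight C V W).obj G := by
  let := changeEnrichment adj C
  refine CategoryTheory.Functor.ext
    (fun x ↦ CategoryTheory.Functor.ext (fun y ↦ rfl) fun y y' f ↦ ?_) fun x x' f ↦ ?_
  -- the `eqToHom`s in `Functor.ext` are identities by definition
  · exact (eHomWhiskerLeft_changeEnrichment adj x.unop f).trans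
      ((Category.id_comp _).trans (Category.comp_id _)).symm
  · ext y
    rw [NatTrans.comp_app, NatTrans.comp_app, eqToHom_app, eqToHom_app]
    exact (eHomWhiskerRight_changeEnrichment adj f.unop y).trans
      ((Category.id_comp _).trans (Category.comp_id _)).symm

theorem isEnrichedModelCategory_changeEnrichment [ModelCategory W] [ModelCategory V]
    [IsWeakMonoidalQuillen adj] [ModelCategory C] [IsEnrichedModelCategory V C] :
    letI := changeEnrichment adj C
    IsEnrichedModelCategory W C := by
  let := changeEnrichment adj C
  have := adj.rightAdjoint_preservesLimits
  exact
    { isTerminal_hom_initial := fun y ↦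
        (IsEnrichedModelCategory.isTerminal_hom_initial (V := V) y).map
          fun h ↦ IsTerminal.isTerminalObj G _ h
      isTerminal_hom_terminal := fun x ↦
        (IsEnrichedModelCategory.isTerminal_hom_terminal (V := V) x).map
          fun h ↦ IsTerminal.isTerminalObj G _ h
      sm7 := by
        rw [eHomFunctor_changeEnrichment adj]
        exact (IsEnrichedModelCategory.sm7 (V := V) (C := C)).comp_rightAdjoint adj
          (IsWeakMonoidalQuillen.isLeftQuillen adj) }

end Enrichment

/-- By SM7, `C(x, y)` is fibrant for cofibrant `x` and fibrant `y`. -/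
lemma isFibrant_eHom (V : Type u₁) [Category.{v₁} V] [MonoidalCategory V] [ModelCategory V]
    {C : Type u₃} [Category.{v₃} C] [ModelCategory C] [EnrichedOrdinaryCategory V C]
    [IsEnrichedModelCategory V C] (x y : C) [IsCofibrant x] [IsFibrant y] :
    IsFibrant (x ⟶[V] y) :=
  (IsEnrichedModelCategory.sm7 (V := V) (C := C)).isFibrant_obj
    (IsEnrichedModelCategory.isTerminal_hom_initial (V := V))
    (IsEnrichedModelCategory.isTerminal_hom_terminal (V := V)) x y

/-! ### Weak tensorings and cotensorings -/

section Main

variable {V : Type u₁} [Category.{v₁} V] [MonoidalCategory V] [SymmetricCategory V]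
  [MonoidalClosed V] [ModelCategory V]
  {W : Type u₂} [Category.{v₂} W] [MonoidalCategory W] [SymmetricCategory W]
  [MonoidalClosed W] [ModelCategory W]
  {F : W ⥤ V} {G : V ⥤ W} [F.OplaxMonoidal] [G.LaxMonoidal]
  (adj : F ⊣ G) [adj.IsMonoidal] [IsWeakMonoidalQuillen adj]

/-- For cofibrant `w` and fibrant `v` the comparison `G[F(w), v] ⟶ [w, G(v)]` is a weak
equivalence, being conjugate to `δ : F(w ⊗ a) ⟶ F(w) ⊗ F(a)`. -/
theorem weakEquivalence_homComparison [IsSymmetricMonoidalModelCategory V]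
    [IsSymmetricMonoidalModelCategory W] (w : W) [IsCofibrant w] (v : V) [IsFibrant v] :
    WeakEquivalence (homComparison adj w v) := by
  have hF := IsWeakMonoidalQuillen.isLeftQuillen adj
  have := hF.isCofibrant_obj adj w
  refine ((isLeftQuillen_tensorLeft w).comp hF).weakEquivalence_of_conjugate
    (hF.comp (isLeftQuillen_tensorLeft (F.obj w)))
    ((ihom.adjunction w).comp adj) (adj.comp (ihom.adjunction (F.obj w)))
    (fun a ↦ Functor.OplaxMonoidal.δ F w a)
    (fun a _ ↦ IsWeakMonoidalQuillen.δ_weakEquivalence adj w a) _ fun {a} g ↦ ?_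
  rw [Adjunction.comp_homEquiv, Adjunction.comp_homEquiv]
  apply homEquiv_symm_uncurry_injective adj
  have h := homEquiv_symm_uncurry_homComparison adj
    (adj.homEquiv _ _ (MonoidalClosed.curry (A := F.obj w) g))
  rw [Equiv.symm_apply_apply, MonoidalClosed.uncurry_curry] at h
  refine h.trans ?_
  symm
  exact (congrArg (adj.homEquiv _ _).symm (MonoidalClosed.uncurry_curry _)).trans
    (Equiv.symm_apply_apply _ _)

/-- For cofibrant `w` and fibrant `h` and `v`, a weak equivalence `φ : h ⟶ [F(w), v]` induces a weak
equivalence `G(h) ⟶ [w, G(v)]`. -/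
lemma weakEquivalence_map_comp_homComparison [IsSymmetricMonoidalModelCategory V]
    [IsSymmetricMonoidalModelCategory W] (w : W) [IsCofibrant w]
    {h v : V} [IsFibrant h] [IsFibrant v] (φ : h ⟶ (ihom (F.obj w)).obj v) [WeakEquivalence φ] :
    WeakEquivalence (G.map φ ≫ homComparison adj w v) := by
  have hF := IsWeakMonoidalQuillen.isLeftQuillen adj
  have := hF.isCofibrant_obj adj w
  have := isFibrant_ihom (F.obj w) v
  have := hF.weakEquivalence_map adj φ
  have := weakEquivalence_homComparison adj w v
  infer_instance

variable {C : Type u₃} [Category.{v₃} C] [ModelCategory C] [EnrichedOrdinaryCategory V C]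
  [IsIso (Functor.OplaxMonoidal.η F)]
  [IsSymmetricMonoidalModelCategory V] [IsSymmetricMonoidalModelCategory W]
  [IsEnrichedModelCategory V C]

theorem TensoringData.IsWeakTensoring.change {T : TensoringData V C} (hT : T.IsWeakTensoring) :
    letI := changeEnrichment adj C
    (T.change adj).IsWeakTensoring := by
  let := changeEnrichment adj C
  have hF := IsWeakMonoidalQuillen.isLeftQuillen adj
  have := adj.leftAdjoint_preservesColimits
  exact
    { isInitial_left := fun w ↦ hT.isInitial_left (F.obj w)
      isInitial_right := fun x ↦ (hT.isInitial_right x).map fun h ↦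
        h.ofIso ((T.tensor.obj x).mapIso
          (initialIsInitial.uniqueUpToIso (IsInitial.isInitialObj F _ initialIsInitial)))
      pushoutProduct := hT.pushoutProduct.comp_isLeftQuillen hF
      φ_natural_tensor := fun w w' f x y ↦ by
        dsimp only [TensoringData.change]
        rw [eHomWhiskerRight_changeEnrichment adj]
        erw [← G.map_comp_assoc, hT.φ_natural_tensor]
        rw [G.map_comp_assoc, homComparison_naturality_left, Category.assoc]
        rfl
      φ_natural_source := fun w x x' g y ↦ by
        dsimp only [TensoringData.change]
        rw [eHomWhiskerRight_changeEnrichment adj, eHomWhiskerRight_changeEnrichment adj]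
        erw [← G.map_comp_assoc, hT.φ_natural_source]
        rw [G.map_comp_assoc, homComparison_naturality_right, Category.assoc]
      φ_natural_target := fun w x y y' g ↦ by
        dsimp only [TensoringData.change]
        rw [eHomWhiskerLeft_changeEnrichment adj, eHomWhiskerLeft_changeEnrichment adj]
        erw [← G.map_comp_assoc, hT.φ_natural_target]
        rw [G.map_comp_assoc, homComparison_naturality_right, Category.assoc]
      φ_weakEquivalence := fun w x y _ _ _ ↦ by
        have := hF.isCofibrant_obj adj w
        have : IsCofibrant ((T.tensor.obj x).obj (F.obj w)) := by
          obtain ⟨h⟩ := hT.isInitial_right x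
          rw [isCofibrant_iff_of_isInitial ((T.tensor.obj x).map (initial.to (F.obj w))) h]
          exact (hT.pushoutProduct.isLeftQuillen hT.isInitial_left x).cofibration_map _
        have := isFibrant_eHom V x y
        have := isFibrant_eHom V ((T.tensor.obj x).obj (F.obj w)) y
        have := hT.φ_weakEquivalence (F.obj w) x y
        exact weakEquivalence_map_comp_homComparison adj w (T.φ (F.obj w) x y)
      ρ_natural := fun x x' g ↦ by
        dsimp [TensoringData.change]
        rw [Category.assoc, ← hT.ρ_natural, ← NatTrans.naturality_assoc]
      ρ_φ := fun x y ↦ by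
        dsimp only [TensoringData.change]
        rw [eHomWhiskerRight_changeEnrichment adj]
        erw [← G.map_comp_assoc]
        rw [eHomWhiskerRight_comp, Category.assoc, hT.φ_natural_tensor, ← Category.assoc,
          hT.ρ_φ]
        exact map_curry_leftUnitor_homComparison adj _ }

theorem CotensoringData.IsWeakCotensoring.change {P : CotensoringData V C}
    (hP : P.IsWeakCotensoring) :
    letI := changeEnrichment adj C
    (P.change adj).IsWeakCotensoring := by
  let := changeEnrichment adj C
  have hF := IsWeakMonoidalQuillen.isLeftQuillen adj
  have := adj.leftAdjoint_preservesColimits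
  exact
    { isTerminal_left := fun y ↦ (hP.isTerminal_left y).map fun h ↦
        h.ofIso ((P.cotensor.flip.obj y).mapIso
          ((IsInitial.isInitialObj F _ initialIsInitial).uniqueUpToIso initialIsInitial).op)
      isTerminal_right := fun w ↦ hP.isTerminal_right (F.obj w)
      pullbackPower := hP.pullbackPower.comp_isLeftQuillen hF
      ψ_natural_cotensor := fun w w' f x y ↦ by
        dsimp only [CotensoringData.change]
        rw [eHomWhiskerLeft_changeEnrichment adj]
        erw [← G.map_comp_assoc, hP.ψ_natural_cotensor]
        rw [G.map_comp_assoc, homComparison_naturality_left, Category.assoc]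
        rfl
      ψ_natural_source := fun w x x' g y ↦ by
        dsimp only [CotensoringData.change]
        rw [eHomWhiskerRight_changeEnrichment adj, eHomWhiskerRight_changeEnrichment adj]
        erw [← G.map_comp_assoc, hP.ψ_natural_source]
        rw [G.map_comp_assoc, homComparison_naturality_right, Category.assoc]
      ψ_natural_target := fun w x y y' g ↦ by
        dsimp only [CotensoringData.change]
        rw [eHomWhiskerLeft_changeEnrichment adj, eHomWhiskerLeft_changeEnrichment adj]
        erw [← G.map_comp_assoc, hP.ψ_natural_target]
        rw [G.map_comp_assoc, homComparison_naturality_right, Category.assoc]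
      ψ_weakEquivalence := fun w x y _ _ _ ↦ by
        have := hF.isCofibrant_obj adj w
        have := hP.pullbackPower.isFibrant_obj hP.isTerminal_left hP.isTerminal_right (F.obj w) y
        have := isFibrant_eHom V x y
        have := isFibrant_eHom V x ((P.cotensor.obj (op (F.obj w))).obj y)
        have := hP.ψ_weakEquivalence (F.obj w) x y
        exact weakEquivalence_map_comp_homComparison adj w (P.ψ (F.obj w) x y)
      η_natural := fun y y' h ↦ by
        dsimp [CotensoringData.change]
        rw [Category.assoc, ← NatTrans.naturality, ← Category.assoc, hP.η_natural,
          Category.assoc]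
        rfl
      η_ψ := fun x y ↦ by
        dsimp only [CotensoringData.change]
        rw [eHomWhiskerLeft_changeEnrichment adj]
        erw [← G.map_comp_assoc]
        rw [eHomWhiskerLeft_comp, Category.assoc, hP.ψ_natural_cotensor, ← Category.assoc,
          hP.η_ψ]
        exact map_curry_leftUnitor_homComparison adj _ }

end Main

end WeakEnrichment

theorem proposition5p3
    {V : Type*} [Category V] [MonoidalCategory V] [SymmetricCategory V] [MonoidalClosed V]
    [ModelCategory V] [WeakEnrichment.IsSymmetricMonoidalModelCategory V]
    {W : Type*} [Category W] [MonoidalCategory W] [SymmetricCategory W] [MonoidalClosed W]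
    [ModelCategory W] [WeakEnrichment.IsSymmetricMonoidalModelCategory W]
    {F : W ⥤ V} {G : V ⥤ W} [F.OplaxMonoidal] [G.LaxMonoidal]
    (adj : F ⊣ G) [adj.IsMonoidal] [WeakEnrichment.IsWeakMonoidalQuillen adj]
    [IsIso (Functor.OplaxMonoidal.η F)]
    (C : Type*) [Category C] [ModelCategory C] [EnrichedOrdinaryCategory V C]
    [WeakEnrichment.IsEnrichedModelCategory V C] :
    letI : EnrichedOrdinaryCategory W C := WeakEnrichment.changeEnrichment adj C
    WeakEnrichment.IsEnrichedModelCategory W C ∧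
    (∀ T : WeakEnrichment.TensoringData V C, T.IsWeakTensoring →
      (T.change adj).IsWeakTensoring ∧
      (T.SetCompatible → (T.change adj).SetCompatible) ∧
      (T.Unital → (T.change adj).Unital)) ∧
    (∀ P : WeakEnrichment.CotensoringData V C, P.IsWeakCotensoring →
      (P.change adj).IsWeakCotensoring ∧
      (P.SetCompatible → (P.change adj).SetCompatible) ∧
      (P.Unital → (P.change adj).Unital)) := by
  refine ⟨WeakEnrichment.isEnrichedModelCategory_changeEnrichment adj,
    fun T hT ↦ ⟨hT.change adj, fun h w x y ↦ ?_, fun h x ↦ ?_⟩,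
    fun P hP ↦ ⟨hP.change adj, fun h w x y ↦ ?_, fun h y ↦ ?_⟩⟩
  · exact WeakEnrichment.bijective_comp_map_comp_homComparison adj _ (h (F.obj w) x y)
  · have := h x
    exact inferInstanceAs (IsIso ((T.tensor.obj x).map (Functor.OplaxMonoidal.η F) ≫ T.ρ x))
  · exact WeakEnrichment.bijective_comp_map_comp_homComparison adj _ (h (F.obj w) x y)
  · have := h y
    exact inferInstanceAs
      (IsIso (P.η y ≫ (P.cotensor.map (Functor.OplaxMonoidal.η F).op).app y))
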